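/- Let $\mathcal H$ be a (real or complex) Hilbert space and let $W=(W_i,w_i)_{i\in I}$ and $V=(V_i,v_i)_{i\in I}$ be fusion frames for $\mathcal H$: the $W_i$ are closed subspaces with orthogonal projections $\pi_{W_i}$, $w_i>0$, and there are $0<A\le B<\infty$ with $A\|f\|^2\le\sum_i w_i^2\|\pi_{W_i}f\|^2\le B\|f\|^2$ for all $f\in\mathcal H$; likewise for $V$. Let $\ell^2(W)=(\sum_i\bigoplus W_i)_{\ell^2}$ be the Hilbert sum, let $T_W:\ell^2(W)\to\mathcal H$, $T_W(f_i)_i=\sum_i w_if_i$, be the synthesis operator, and let $S_W=T_WT_W^*$ be the (positive, invertible) fusion frame operator; define $\ell^2(V),T_V,S_V$ in the same way. For bounded operators put $(S\otimes T)(O)=S\,O\,T^*$. Write $S_2(\mathcal H)$ and $S_2(\ell^2(V),\ell^2(W))$ for the Hilbert spaces of Hilbert–Schmidt operators $\mathcal H\to\mathcal H$ and $\ell^2(V)\to\ell^2(W)$, with the inner product given by $\operatorname{trace}(U_1^*U_2)$. Consider the bounded operators $$\mathcal M_{HS}^{(W,V)}:S_2(\mathcal H)\to S_2(\ell^2(V),\ell^2(W)),\quad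 O\mapsto (T_W^*\otimes T_V^*)(O)=T_W^*OT_V,$$ $$\mathcal O_{HS}^{(W,V)}:S_2(\ell^2(V),\ell^2(W))\to S_2(\mathcal H),\quad M\mapsto (T_W\otimes T_V)(M)=T_WMT_V^*,$$ $$\mathcal M_{\otimes HS}^{(W,V)}=\mathcal M_{HS}^{(W,V)}\circ\big(S_W^{-1/2}\otimes S_V^{-1/2}\big),\qquad \mathcal O_{\otimes HS}^{(W,V)}=\big(S_W^{-1/2}\otimes S_V^{-1/2}\big)\circ\mathcal O_{HS}^{(W,V)}.$$ For a bounded operator $U:\mathcal K_1\to\mathcal K_2$ between Hilbert spaces with closed range, its pseudo-inverse $U^\dagger:\mathcal K_2\to\mathcal K_1$ is the unique bounded operator with $\operatorname{ran}U^\dagger=\operatorname{ran}U^*$, $\ker U^\dagger=\ker U^*$ and $UU^\dagger U=U$. Then $\mathcal M_{HS}^{(W,V)}$ and $\mathcal M_{\otimes HS}^{(W,V)}$ have closed range, and 1. $\big(\mathcal M_{HS}^{(W,V)}\big)^\dagger=\big(S_W^{-1}\otimes S_V^{-1}\big)\circ\mathcal O_{HS}^{(W,V)}$; 2. $\big(\mathcal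 M_{\otimes HS}^{(W,V)}\big)^\dagger=\mathcal O_{\otimes HS}^{(W,V)}$. -/

import Mathlib

set_option linter.unusedSectionVars false

noncomputable section

namespace FusionFrames

open scoped ENNReal InnerProductSpace

section HilbertSchmidt

variable {𝕜 : Type*} [RCLike 𝕜]
variable {E : Type*} [NormedAddCommGroup E] [InnerProductSpace 𝕜 E] [CompleteSpace E]
variable {F : Type*} [NormedAddCommGroup F] [InnerProductSpace 𝕜 F] [CompleteSpace F]
variable {G : Type*} [NormedAddCommGroup G] [InnerProductSpace 𝕜 G] [CompleteSpace G]
variable {K : Type*} [NormedAddCommGroup K] [InnerProductSpace 𝕜 K] [CompleteSpace K]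

/-- Assembles a family of operators `L i : E → X i` with `∑ ‖L i x‖² ≤ C ‖x‖²` into one bounded
operator from `E` to the Hilbert sum of the `X i`. -/
def toHilbertSum {ι : Type*} {X : ι → Type*} [∀ i, NormedAddCommGroup (X i)]
    [∀ i, InnerProductSpace 𝕜 (X i)] (L : ∀ i, E →L[𝕜] X i)
    (h : ∃ C : ℝ, ∀ x, Summable (fun i => ‖L i x‖ ^ 2) ∧ ∑' i, ‖L i x‖ ^ 2 ≤ C * ‖x‖ ^ 2) :
    E →L[𝕜] lp X 2 :=
  LinearMap.mkContinuousOfExistsBound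
    { toFun := fun x => ⟨fun i => L i x, by
        obtain ⟨C, hC⟩ := h
        refine memℓp_gen ?_
        simpa using (hC x).1⟩
      map_add' := fun x y => by ext i; exact map_add (L i) x y
      map_smul' := fun c x => by ext i; exact map_smul (L i) c x } (by
    obtain ⟨C, hC⟩ := h
    refine ⟨√(max C 0), fun x => ?_⟩
    have h2 : ((2 : ℝ≥0∞).toReal) = 2 := by simp
    have key := lp.norm_rpow_eq_tsum (p := 2) (E := X) (by simp)
      ⟨fun i => L i x, memℓp_gen (by simpa using (hC x).1)⟩
    simp only [h2, Real.rpow_two] at key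
    refine (pow_le_pow_iff_left₀ (norm_nonneg _) (by positivity) two_ne_zero).mp ?_
    rw [mul_pow, Real.sq_sqrt (le_max_right _ _)]
    exact key.trans_le ((hC x).2.trans (by gcongr; exact le_max_left _ _)))

@[simp]
theorem toHilbertSum_apply {ι : Type*} {X : ι → Type*} [∀ i, NormedAddCommGroup (X i)]
    [∀ i, InnerProductSpace 𝕜 (X i)] (L : ∀ i, E →L[𝕜] X i)
    (h : ∃ C : ℝ, ∀ x, Summable (fun i => ‖L i x‖ ^ 2) ∧ ∑' i, ‖L i x‖ ^ 2 ≤ C * ‖x‖ ^ 2)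
    (x : E) (i : ι) : (toHilbertSum L h x : ∀ i, X i) i = L i x := rfl

variable (𝕜 E) in
/-- The index set of a fixed orthonormal basis of the Hilbert space `E`. -/
def OnbIndex : Set E := (exists_hilbertBasis 𝕜 E).choose

variable (𝕜 E) in
/-- A fixed orthonormal (Hilbert) basis of the Hilbert space `E`. -/
def onb : HilbertBasis (OnbIndex 𝕜 E) 𝕜 E := (exists_hilbertBasis 𝕜 E).choose_spec.choose

theorem hasSum_sq_inner {ι : Type*} (b : HilbertBasis ι 𝕜 E) (x : E) :
    HasSum (fun i => ‖⟪b i, x⟫_𝕜‖ ^ 2) (‖x‖ ^ 2) := by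
  have h := b.hasSum_inner_mul_inner x x
  have h' := RCLike.hasSum_re 𝕜 h
  rw [inner_self_eq_norm_sq] at h'
  convert h' using 2 with i
  rw [← inner_conj_symm x (b i), RCLike.conj_mul, ← RCLike.ofReal_pow, RCLike.ofReal_re]

theorem tsum_enorm_inner {ι : Type*} (b : HilbertBasis ι 𝕜 E) (x : E) :
    ∑' i, ENNReal.ofReal (‖⟪b i, x⟫_𝕜‖ ^ 2) = ENNReal.ofReal (‖x‖ ^ 2) := by
  rw [← ENNReal.ofReal_tsum_of_nonneg (fun i => by positivity) (hasSum_sq_inner b x).summable,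
    (hasSum_sq_inner b x).tsum_eq]

theorem tsum_adjoint {ι κ : Type*} (b : HilbertBasis ι 𝕜 E) (c : HilbertBasis κ 𝕜 F)
    (T : E →L[𝕜] F) :
    ∑' i, ENNReal.ofReal (‖T (b i)‖ ^ 2) =
      ∑' j, ENNReal.ofReal (‖ContinuousLinearMap.adjoint T (c j)‖ ^ 2) := by
  simp_rw [← tsum_enorm_inner c (T _), ← tsum_enorm_inner b (ContinuousLinearMap.adjoint T _)]
  rw [ENNReal.tsum_comm]
  congr! 6 with j i
  rw [ContinuousLinearMap.adjoint_inner_right, norm_inner_symm]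

theorem tsum_basis_indep {ι κ : Type*} (b : HilbertBasis ι 𝕜 E) (c : HilbertBasis κ 𝕜 E)
    (T : E →L[𝕜] F) :
    ∑' i, ENNReal.ofReal (‖T (b i)‖ ^ 2) = ∑' j, ENNReal.ofReal (‖T (c j)‖ ^ 2) := by
  rw [tsum_adjoint b (onb 𝕜 F), tsum_adjoint c (onb 𝕜 F)]

/-- `T` is a Hilbert–Schmidt operator: `∑ ‖T eᵢ‖² < ∞` for an orthonormal basis `(eᵢ)`. -/
def IsHilbertSchmidt (T : E →L[𝕜] F) : Prop :=
  Summable fun i => ‖T (onb 𝕜 E i)‖ ^ 2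

theorem summable_iff_tsum_ne_top {ι : Type*} {f : ι → ℝ} (hf : ∀ i, 0 ≤ f i) :
    Summable f ↔ ∑' i, ENNReal.ofReal (f i) ≠ ⊤ := by
  refine ⟨fun h => h.tsum_ofReal_ne_top, fun h => ?_⟩
  have := ENNReal.summable_toReal h
  simpa [ENNReal.toReal_ofReal (hf _)] using this

/-- Being Hilbert–Schmidt does not depend on the orthonormal basis. -/
theorem isHilbertSchmidt_iff {ι : Type*} (b : HilbertBasis ι 𝕜 E) (T : E →L[𝕜] F) :
    IsHilbertSchmidt T ↔ Summable fun i => ‖T (b i)‖ ^ 2 := by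
  rw [IsHilbertSchmidt, summable_iff_tsum_ne_top (fun i => by positivity),
    summable_iff_tsum_ne_top (fun i => by positivity), tsum_basis_indep (onb 𝕜 E) b]

theorem IsHilbertSchmidt.memℓp {T : E →L[𝕜] F} (hT : IsHilbertSchmidt T) :
    Memℓp (fun i : OnbIndex 𝕜 E => T (onb 𝕜 E i)) 2 :=
  memℓp_gen (by simpa [IsHilbertSchmidt] using hT)

theorem isHilbertSchmidt_of_memℓp {T : E →L[𝕜] F}
    (hT : Memℓp (fun i : OnbIndex 𝕜 E => T (onb 𝕜 E i)) 2) : IsHilbertSchmidt T := by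
  simpa [IsHilbertSchmidt] using hT.summable (by simp)

variable (𝕜 E F) in
/-- The Hilbert–Schmidt operators, as a linear subspace of the bounded operators. -/
def hilbertSchmidtSubmodule : Submodule 𝕜 (E →L[𝕜] F) where
  carrier := {T | IsHilbertSchmidt T}
  zero_mem' := isHilbertSchmidt_of_memℓp (by simpa using! zero_memℓp)
  add_mem' {S T} hS hT := isHilbertSchmidt_of_memℓp (by simpa using! hS.memℓp.add hT.memℓp)
  smul_mem' c T hT := isHilbertSchmidt_of_memℓp (by simpa using! hT.memℓp.const_smul c)

variable (𝕜 E F) in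
/-- The Hilbert–Schmidt class `S₂(E, F)`. This is a type of its own (not a subspace of
`E →L[𝕜] F` with the operator norm), so that it can carry the Hilbert–Schmidt norm. -/
def S2 : Type _ := hilbertSchmidtSubmodule 𝕜 E F

namespace S2

instance : AddCommGroup (S2 𝕜 E F) := inferInstanceAs (AddCommGroup (hilbertSchmidtSubmodule 𝕜 E F))

instance : Module 𝕜 (S2 𝕜 E F) := inferInstanceAs (Module 𝕜 (hilbertSchmidtSubmodule 𝕜 E F))

variable (𝕜 E F) in
/-- The inclusion of `S₂(E, F)` into the bounded operators. -/
def toCLM : S2 𝕜 E F →ₗ[𝕜] (E →L[𝕜] F) := (hilbertSchmidtSubmodule 𝕜 E F).subtype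

theorem toCLM_injective : Function.Injective (toCLM 𝕜 E F) := Subtype.val_injective

theorem isHilbertSchmidt (T : S2 𝕜 E F) : IsHilbertSchmidt (toCLM 𝕜 E F T) := T.2

/-- A Hilbert–Schmidt operator as an element of `S₂(E, F)`. -/
def mk (T : E →L[𝕜] F) (hT : IsHilbertSchmidt T) : S2 𝕜 E F := ⟨T, hT⟩

@[simp] theorem toCLM_mk (T : E →L[𝕜] F) (hT : IsHilbertSchmidt T) :
    toCLM 𝕜 E F (mk T hT) = T := rfl

end S2

/-- The trace `∑ ⟨A eᵢ, eᵢ⟩` of an operator (used for trace class operators); Mathlib's inner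
product is linear in the second argument. -/
def trace (A : E →L[𝕜] E) : 𝕜 := ∑' i, ⟪onb 𝕜 E i, A (onb 𝕜 E i)⟫_𝕜

namespace S2

variable (𝕜 E F) in
/-- The coordinates `(T eᵢ)ᵢ` of a Hilbert–Schmidt operator. -/
def coords : S2 𝕜 E F →ₗ[𝕜] lp (fun _ : OnbIndex 𝕜 E => F) 2 where
  toFun T := ⟨fun i => toCLM 𝕜 E F T (onb 𝕜 E i), T.isHilbertSchmidt.memℓp⟩
  map_add' S T := by ext i; rfl
  map_smul' c T := by ext i; rfl

/-- The inner product `⟨S, T⟩ = trace (S* T)`. -/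
instance : Inner 𝕜 (S2 𝕜 E F) where
  inner S T := trace (ContinuousLinearMap.adjoint (toCLM 𝕜 E F S) ∘L toCLM 𝕜 E F T)

theorem inner_eq_coords (S T : S2 𝕜 E F) :
    ⟪S, T⟫_𝕜 = ⟪coords 𝕜 E F S, coords 𝕜 E F T⟫_𝕜 := by
  rw [lp.inner_eq_tsum]
  change trace _ = _
  unfold trace
  congr! 2 with i
  simp only [ContinuousLinearMap.comp_apply, ContinuousLinearMap.adjoint_inner_right]
  rfl

theorem inner_def (S T : S2 𝕜 E F) :
    ⟪S, T⟫_𝕜 = trace (ContinuousLinearMap.adjoint (toCLM 𝕜 E F S) ∘L toCLM 𝕜 E F T) := rfl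

theorem ext_basis {ι : Type*} (b : HilbertBasis ι 𝕜 E) {S T : E →L[𝕜] F}
    (h : ∀ i, S (b i) = T (b i)) : S = T := by
  refine ContinuousLinearMap.ext_on (s := Set.range b) ?_ ?_
  · rw [dense_iff_closure_eq, ← Submodule.topologicalClosure_coe, b.dense_span]; rfl
  · rintro _ ⟨i, rfl⟩; exact h i

theorem coords_injective : Function.Injective (coords 𝕜 E F) := by
  intro S T h
  refine toCLM_injective (ext_basis (onb 𝕜 E) fun i => ?_)
  exact congrArg (fun f : lp (fun _ : OnbIndex 𝕜 E => F) 2 => (f : OnbIndex 𝕜 E → F) i) h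

variable (𝕜 E F) in
/-- The inner product space structure of `S₂(E, F)`. -/
abbrev core : InnerProductSpace.Core 𝕜 (S2 𝕜 E F) where
  inner S T := ⟪S, T⟫_𝕜
  conj_inner_symm S T := by simp only [inner_eq_coords]; exact inner_conj_symm _ _
  re_inner_nonneg T := by simp only [inner_eq_coords]; exact inner_self_nonneg
  add_left R S T := by simp only [inner_eq_coords, map_add]; exact inner_add_left _ _ _
  smul_left S T c := by simp only [inner_eq_coords, map_smul]; exact inner_smul_left _ _ _
  definite T h := by
    simp only [inner_eq_coords] at h
    exact coords_injective ((inner_self_eq_zero.mp h).trans (map_zero _).symm)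

instance : NormedAddCommGroup (S2 𝕜 E F) := (core 𝕜 E F).toNormedAddCommGroup

instance : InnerProductSpace 𝕜 (S2 𝕜 E F) := InnerProductSpace.ofCore (core 𝕜 E F).toCore

theorem norm_coords (T : S2 𝕜 E F) : ‖coords 𝕜 E F T‖ = ‖T‖ := by
  rw [@norm_eq_sqrt_re_inner 𝕜, @norm_eq_sqrt_re_inner 𝕜 _ _ _ _ T, inner_eq_coords]

/-- `‖T‖² = ∑ ‖T eᵢ‖²`, for every orthonormal basis. -/
theorem ofReal_norm_sq {ι : Type*} (b : HilbertBasis ι 𝕜 E) (T : S2 𝕜 E F) :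
    ENNReal.ofReal (‖T‖ ^ 2) = ∑' i, ENNReal.ofReal (‖toCLM 𝕜 E F T (b i)‖ ^ 2) := by
  have h := lp.norm_rpow_eq_tsum (p := 2) (by simp) (coords 𝕜 E F T)
  have h2 : ((2 : ℝ≥0∞).toReal) = 2 := by simp
  simp only [h2, Real.rpow_two, norm_coords] at h
  rw [h, tsum_basis_indep b (onb 𝕜 E)]
  exact ENNReal.ofReal_tsum_of_nonneg (fun i => by positivity) T.isHilbertSchmidt

theorem coords_surjective : Function.Surjective (coords 𝕜 E F) := by
  intro a
  have ha : Summable fun i => ‖a i‖ ^ 2 := by simpa using a.2.summable (by simp)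
  have hle : ∀ (y : F) i, ‖innerSL 𝕜 (a i) y‖ ^ 2 ≤ ‖a i‖ ^ 2 * ‖y‖ ^ 2 := fun y i => by
    rw [← mul_pow, innerSL_apply_apply]
    gcongr
    exact norm_inner_le_norm _ _
  let A : F →L[𝕜] lp (fun _ : OnbIndex 𝕜 E => 𝕜) 2 :=
    toHilbertSum (fun i => innerSL 𝕜 (a i)) ⟨∑' i, ‖a i‖ ^ 2, fun y => by
      have hs := Summable.of_nonneg_of_le (fun i => by positivity) (hle y) (ha.mul_right _)
      exact ⟨hs, (hs.tsum_le_tsum (hle y) (ha.mul_right _)).trans_eq tsum_mul_right⟩⟩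
  let B : F →L[𝕜] E := ((onb 𝕜 E).repr.symm.toContinuousLinearEquiv :
    lp (fun _ : OnbIndex 𝕜 E => 𝕜) 2 →L[𝕜] E) ∘L A
  have hB : ∀ i, ContinuousLinearMap.adjoint B (onb 𝕜 E i) = a i := fun i => by
    refine ext_inner_right 𝕜 fun y => ?_
    rw [ContinuousLinearMap.adjoint_inner_left, ← HilbertBasis.repr_apply_apply]
    simp [B, A]
  refine ⟨mk (ContinuousLinearMap.adjoint B) ?_, ?_⟩
  · simpa [IsHilbertSchmidt, hB] using ha
  · ext i; exact hB i

instance : CompleteSpace (S2 𝕜 E F) := by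
  let e : S2 𝕜 E F ≃ₗᵢ[𝕜] lp (fun _ : OnbIndex 𝕜 E => F) 2 :=
    LinearIsometryEquiv.ofSurjective ⟨coords 𝕜 E F, norm_coords⟩ coords_surjective
  exact (completeSpace_congr (e := e.toEquiv) e.isometry.isUniformEmbedding).mpr inferInstance

end S2

/-- The tensor product of operators, `(S ⊗ T)(O) = S O T*`, acting on bounded operators. -/
def tensor (S : F →L[𝕜] K) (T : E →L[𝕜] G) : (E →L[𝕜] F) →ₗ[𝕜] (G →L[𝕜] K) where
  toFun O := S ∘L O ∘L ContinuousLinearMap.adjoint T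
  map_add' O P := by ext; simp
  map_smul' c O := by ext; simp

theorem tsum_comp_le {ι : Type*} (v : ι → E) (A : F →L[𝕜] G) (B : E →L[𝕜] F) :
    ∑' i, ENNReal.ofReal (‖A (B (v i))‖ ^ 2) ≤
      ENNReal.ofReal (‖A‖ ^ 2) * ∑' i, ENNReal.ofReal (‖B (v i)‖ ^ 2) := by
  rw [← ENNReal.tsum_mul_left]
  refine ENNReal.tsum_le_tsum fun i => ?_
  rw [← ENNReal.ofReal_mul (by positivity), ← mul_pow]
  gcongr
  exact A.le_opNorm _

theorem tsum_tensor_le {ι κ : Type*} (b : HilbertBasis ι 𝕜 E) (c : HilbertBasis κ 𝕜 G)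
    (S : F →L[𝕜] K) (T : E →L[𝕜] G) (O : E →L[𝕜] F) :
    ∑' i, ENNReal.ofReal (‖tensor S T O (c i)‖ ^ 2) ≤
      ENNReal.ofReal ((‖S‖ * ‖T‖) ^ 2) * ∑' i, ENNReal.ofReal (‖O (b i)‖ ^ 2) := by
  refine (tsum_comp_le (fun i => ContinuousLinearMap.adjoint T (c i)) S O).trans ?_
  rw [mul_pow, ENNReal.ofReal_mul (by positivity), mul_assoc]
  gcongr
  have h := tsum_adjoint c (onb 𝕜 F) (O ∘L ContinuousLinearMap.adjoint T)
  rw [ContinuousLinearMap.adjoint_comp, ContinuousLinearMap.adjoint_adjoint] at h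
  refine h.le.trans ((tsum_comp_le (onb 𝕜 F) T (ContinuousLinearMap.adjoint O)).trans_eq ?_)
  rw [tsum_adjoint b (onb 𝕜 F) O]

theorem IsHilbertSchmidt.tensor (S : F →L[𝕜] K) (T : E →L[𝕜] G) {O : E →L[𝕜] F}
    (hO : IsHilbertSchmidt O) : IsHilbertSchmidt (tensor S T O) := by
  rw [IsHilbertSchmidt, summable_iff_tsum_ne_top (fun i => by positivity)] at hO ⊢
  exact ne_top_of_le_ne_top (ENNReal.mul_ne_top ENNReal.ofReal_ne_top hO)
    (tsum_tensor_le (onb 𝕜 E) (onb 𝕜 G) S T O)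

/-- `S ⊗ T` restricted to the Hilbert–Schmidt operators, as a bounded operator between the
Hilbert–Schmidt classes. -/
def tensorHS (S : F →L[𝕜] K) (T : E →L[𝕜] G) : S2 𝕜 E F →L[𝕜] S2 𝕜 G K :=
  LinearMap.mkContinuous
    { toFun := fun O => S2.mk (tensor S T (S2.toCLM 𝕜 E F O)) (O.isHilbertSchmidt.tensor S T)
      map_add' := fun O P => S2.toCLM_injective (by simp)
      map_smul' := fun c O => S2.toCLM_injective (by simp) }
    (‖S‖ * ‖T‖) fun O => by
      refine (pow_le_pow_iff_left₀ (norm_nonneg _) (by positivity) two_ne_zero).mp ?_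
      rw [mul_pow, ← ENNReal.ofReal_le_ofReal_iff (by positivity),
        ENNReal.ofReal_mul (by positivity), S2.ofReal_norm_sq (onb 𝕜 E),
        S2.ofReal_norm_sq (onb 𝕜 G)]
      exact tsum_tensor_le (onb 𝕜 E) (onb 𝕜 G) S T _

@[simp] theorem toCLM_tensorHS (S : F →L[𝕜] K) (T : E →L[𝕜] G) (O : S2 𝕜 E F) :
    S2.toCLM 𝕜 G K (tensorHS S T O) = tensor S T (S2.toCLM 𝕜 E F O) := rfl

/-- `P` is the pseudo-inverse of the bounded operator `U`. -/
structure IsPseudoInverse (U : E →L[𝕜] F) (P : F →L[𝕜] E) : Prop where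
  range_eq : P.range = (ContinuousLinearMap.adjoint U).range
  ker_eq : P.ker = (ContinuousLinearMap.adjoint U).ker
  comp_comp : U ∘L P ∘L U = U

/-- An operator with closed range has at most one pseudo-inverse. -/
theorem IsPseudoInverse.unique {U : E →L[𝕜] F} (hU : IsClosed (U.range : Set F))
    {P Q : F →L[𝕜] E} (hP : IsPseudoInverse U P) (hQ : IsPseudoInverse U Q) : P = Q := by
  have hUcomplete : CompleteSpace U.range := hU.completeSpace_coe
  ext y
  have key : P y - Q y = 0 := by
    have h1 : P y - Q y ∈ (ContinuousLinearMap.adjoint U).range :=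
      Submodule.sub_mem _ (hP.range_eq ▸ ⟨y, rfl⟩) (hQ.range_eq ▸ ⟨y, rfl⟩)
    have h2 : U (P y) = U (Q y) := by
      obtain ⟨_, ⟨x, rfl⟩, z, hz, rfl⟩ := U.range.exists_add_mem_mem_orthogonal y
      rw [ContinuousLinearMap.orthogonal_range] at hz
      have hzP : P z = 0 := by rw [← hP.ker_eq] at hz; exact hz
      have hzQ : Q z = 0 := by rw [← hQ.ker_eq] at hz; exact hz
      have e1 := congrArg (fun f : E →L[𝕜] F => f x) hP.comp_comp
      have e2 := congrArg (fun f : E →L[𝕜] F => f x) hQ.comp_comp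
      simp only [ContinuousLinearMap.comp_apply] at e1 e2
      simp only [map_add, hzP, hzQ, add_zero]
      exact e1.trans e2.symm
    obtain ⟨w, hw⟩ := h1
    have h3 : U (P y - Q y) = 0 := by rw [map_sub, h2, sub_self]
    rw [← inner_self_eq_zero (𝕜 := 𝕜)]
    nth_rewrite 1 [← hw]
    change ⟪ContinuousLinearMap.adjoint U w, _⟫_𝕜 = 0
    rw [ContinuousLinearMap.adjoint_inner_left, h3, inner_zero_right]
  exact sub_eq_zero.mp key

open Classical in
/-- The square root of a positive operator: the positive operator `R` with `R R = T`. -/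
def posSqrt (T : E →L[𝕜] E) : E →L[𝕜] E :=
  if h : ∃ R : E →L[𝕜] E, R.IsPositive ∧ R ∘L R = T then h.choose else 0

/-- A self-adjoint operator that is bounded below by a positive constant has a positive square
root. -/
theorem exists_posSqrt {T : E →L[𝕜] E} (hT : IsSelfAdjoint T) {a : ℝ} (ha : 0 < a)
    (hTa : ∀ x, a * ‖x‖ ^ 2 ≤ RCLike.re ⟪T x, x⟫_𝕜) :
    ∃ R : E →L[𝕜] E, R.IsPositive ∧ R ∘L R = T := by
  obtain ⟨c, hc, hca⟩ : ∃ c : ℝ, 0 < c ∧ c * ‖T‖ ^ 2 ≤ a := by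
    refine ⟨a / (‖T‖ ^ 2 + 1), by positivity, ?_⟩
    rw [div_mul_eq_mul_div, div_le_iff₀ (by positivity)]
    nlinarith
  set q : ℝ := √(1 - c * a) with hq
  have hq0 : 0 ≤ q := Real.sqrt_nonneg _
  have hq1 : q < 1 := by
    rw [hq, Real.sqrt_lt' one_pos]
    nlinarith [mul_pos hc ha]
  set A : E →L[𝕜] E := 1 - (c : 𝕜) • T with hA
  have hAq : ‖A‖ ≤ q := by
    refine A.opNorm_le_bound hq0 fun x => ?_
    refine (pow_le_pow_iff_left₀ (norm_nonneg _) (by positivity) two_ne_zero).mp ?_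
    have e1 : ‖A x‖ ^ 2 = ‖x‖ ^ 2 - 2 * c * RCLike.re ⟪T x, x⟫_𝕜 + c ^ 2 * ‖T x‖ ^ 2 := by
      simp only [hA, sub_apply, one_apply_eq_self, smul_apply]
      rw [@norm_sub_sq 𝕜, inner_smul_right, norm_smul, RCLike.re_ofReal_mul,
        RCLike.norm_ofReal, mul_pow, sq_abs, inner_re_symm]
      ring
    have e2 : ‖T x‖ ^ 2 ≤ ‖T‖ ^ 2 * ‖x‖ ^ 2 := by
      rw [← mul_pow]; gcongr; exact T.le_opNorm x
    have e3 : ‖A x‖ ^ 2 ≤ (1 - c * a) * ‖x‖ ^ 2 := by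
      have e4 : c ^ 2 * ‖T x‖ ^ 2 ≤ c * (a * ‖x‖ ^ 2) := by
        calc c ^ 2 * ‖T x‖ ^ 2 ≤ c ^ 2 * (‖T‖ ^ 2 * ‖x‖ ^ 2) := by gcongr
          _ = c * ((c * ‖T‖ ^ 2) * ‖x‖ ^ 2) := by ring
          _ ≤ c * (a * ‖x‖ ^ 2) := by gcongr
      have e5 := mul_le_mul_of_nonneg_left (hTa x) hc.le
      nlinarith
    refine e3.trans ?_
    rw [mul_pow]
    gcongr
    rcases le_or_gt 0 (1 - c * a) with h | h
    · rw [hq, Real.sq_sqrt h]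
    · exact h.le.trans (by positivity)
  have hAs : IsSelfAdjoint A := by
    refine (IsSelfAdjoint.one _).sub (IsSelfAdjoint.smul ?_ hT)
    simp [IsSelfAdjoint]
  let f : (E →L[𝕜] E) → (E →L[𝕜] E) := fun Y => ((1 / 2 : ℝ) : 𝕜) • (A + Y * Y)
  have hhalf : ∀ Z : E →L[𝕜] E, ‖((1 / 2 : ℝ) : 𝕜) • Z‖ = 1 / 2 * ‖Z‖ := fun Z => by
    rw [norm_smul, RCLike.norm_ofReal, abs_of_pos (by norm_num)]
  let s : Set (E →L[𝕜] E) := {Y | ‖Y‖ ≤ q ∧ star Y = Y}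
  have hsc : IsComplete s := IsClosed.isComplete
    ((isClosed_le continuous_norm continuous_const).inter
      (isClosed_eq continuous_star continuous_id))
  have hsf : Set.MapsTo f s s := by
    rintro Y ⟨hY1, hY2⟩
    refine ⟨?_, ?_⟩
    · rw [hhalf]
      have h1 : ‖A + Y * Y‖ ≤ q + q * q :=
        (norm_add_le _ _).trans (add_le_add hAq ((norm_mul_le _ _).trans (by gcongr)))
      nlinarith
    · simp [f, hY2, hAs.star_eq]
  have hf : ContractingWith ⟨q, hq0⟩ (hsf.restrict f s s) := by
    refine ⟨hq1, LipschitzWith.of_dist_le_mul ?_⟩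
    rintro ⟨Y, hY1, hY2⟩ ⟨Z, hZ1, hZ2⟩
    change dist (f Y) (f Z) ≤ q * dist Y Z
    rw [dist_eq_norm, dist_eq_norm]
    have h1 : f Y - f Z = ((1 / 2 : ℝ) : 𝕜) • (Y * (Y - Z) + (Y - Z) * Z) := by
      simp only [f, ← smul_sub]
      congr 1
      noncomm_ring
    rw [h1, hhalf]
    have h2 : ‖Y * (Y - Z) + (Y - Z) * Z‖ ≤ q * ‖Y - Z‖ + ‖Y - Z‖ * q :=
      (norm_add_le _ _).trans (add_le_add ((norm_mul_le _ _).trans (by gcongr))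
        ((norm_mul_le _ _).trans (by gcongr)))
    linarith
  obtain ⟨Y, ⟨hY1, hY2⟩, hYf, -⟩ := hf.exists_fixedPoint' hsc hsf
    (x := 0) ⟨by simpa using hq0, by simp⟩ (edist_ne_top _ _)
  have hYY : Y + Y = A + Y * Y := by
    have h1 : ((1 / 2 : ℝ) : 𝕜) • (A + Y * Y) = Y := hYf
    have h2 : A + Y * Y = (2 : 𝕜) • Y := by
      conv_rhs => rw [← h1]
      rw [smul_smul]
      have : (2 : 𝕜) * ((1 / 2 : ℝ) : 𝕜) = 1 := by
        rw [← RCLike.ofReal_ofNat, ← RCLike.ofReal_mul]; norm_num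
      rw [this, one_smul]
    rw [h2, two_smul]
  have hc' : ((√c)⁻¹ * (√c)⁻¹ * c : ℝ) = 1 := by
    rw [← mul_inv, Real.mul_self_sqrt hc.le, inv_mul_cancel₀ hc.ne']
  have hX : (1 - Y) * (1 - Y) = (c : 𝕜) • T := by
    have : (1 - Y) * (1 - Y) = 1 - (Y + Y) + Y * Y := by noncomm_ring
    rw [this, hYY, hA]; abel
  refine ⟨(((√c)⁻¹ : ℝ) : 𝕜) • (1 - Y), ?_, ?_⟩
  · refine ContinuousLinearMap.IsPositive.smul_of_nonneg ?_
      (RCLike.ofReal_nonneg.mpr (by positivity))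
    rw [ContinuousLinearMap.isPositive_def']
    refine ⟨(IsSelfAdjoint.one _).sub hY2, fun x => ?_⟩
    have h1 : RCLike.re ⟪Y x, x⟫_𝕜 ≤ ‖x‖ ^ 2 := by
      refine (RCLike.re_le_norm _).trans ((norm_inner_le_norm _ _).trans ?_)
      rw [sq]
      gcongr
      exact (Y.le_opNorm x).trans (by nlinarith [norm_nonneg x])
    rw [ContinuousLinearMap.reApplyInnerSelf_apply, sub_apply, one_apply_eq_self,
      inner_sub_left, map_sub, inner_self_eq_norm_sq]
    linarith
  · change ((((√c)⁻¹ : ℝ) : 𝕜) • (1 - Y)) * ((((√c)⁻¹ : ℝ) : 𝕜) • (1 - Y)) = T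
    rw [smul_mul_smul_comm, hX, smul_smul, ← RCLike.ofReal_mul, ← RCLike.ofReal_mul, hc',
      RCLike.ofReal_one, one_smul]

theorem posSqrt_spec {T : E →L[𝕜] E} (h : ∃ R : E →L[𝕜] E, R.IsPositive ∧ R ∘L R = T) :
    (posSqrt T).IsPositive ∧ posSqrt T ∘L posSqrt T = T := by
  rw [posSqrt, dif_pos h]; exact h.choose_spec

/-- The inverse square root `T^{-1/2} = (T^{1/2})⁻¹` of an invertible positive operator. -/
def invSqrt (T : E →L[𝕜] E) : E →L[𝕜] E := (posSqrt T).inverse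

end HilbertSchmidt

section Fusion

variable {ι : Type*} {𝕜 : Type*} [RCLike 𝕜]
variable {H : Type*} [NormedAddCommGroup H] [InnerProductSpace 𝕜 H] [CompleteSpace H]

variable (ι 𝕜 H) in
/-- A family of closed subspaces `Wᵢ` of `H` with weights `wᵢ > 0`. -/
structure WeightedSubspaces where
  space : ι → ClosedSubmodule 𝕜 H
  weight : ι → ℝ
  weight_pos : ∀ i, 0 < weight i

namespace WeightedSubspaces

/-- `(Wᵢ, wᵢ)` is a Bessel fusion sequence: `∑ wᵢ² ‖π_{Wᵢ} f‖² ≤ B ‖f‖²`. -/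
def IsBessel (W : WeightedSubspaces ι 𝕜 H) : Prop :=
  ∃ B : ℝ, ∀ f : H,
    Summable (fun i => W.weight i ^ 2 * ‖(W.space i).toSubmodule.starProjection f‖ ^ 2) ∧
    ∑' i, W.weight i ^ 2 * ‖(W.space i).toSubmodule.starProjection f‖ ^ 2 ≤ B * ‖f‖ ^ 2

/-- `(Wᵢ, wᵢ)` is a fusion frame: `A ‖f‖² ≤ ∑ wᵢ² ‖π_{Wᵢ} f‖² ≤ B ‖f‖²` with `0 < A ≤ B`. -/
def IsFusionFrame (W : WeightedSubspaces ι 𝕜 H) : Prop :=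
  ∃ A B : ℝ, 0 < A ∧ A ≤ B ∧ ∀ f : H,
    Summable (fun i => W.weight i ^ 2 * ‖(W.space i).toSubmodule.starProjection f‖ ^ 2) ∧
    A * ‖f‖ ^ 2 ≤ ∑' i, W.weight i ^ 2 * ‖(W.space i).toSubmodule.starProjection f‖ ^ 2 ∧
    ∑' i, W.weight i ^ 2 * ‖(W.space i).toSubmodule.starProjection f‖ ^ 2 ≤ B * ‖f‖ ^ 2

theorem IsFusionFrame.isBessel {W : WeightedSubspaces ι 𝕜 H} (hW : W.IsFusionFrame) :
    W.IsBessel := by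
  obtain ⟨A, B, -, -, h⟩ := hW
  exact ⟨B, fun f => ⟨(h f).1, (h f).2.2⟩⟩

instance (W : WeightedSubspaces ι 𝕜 H) (i : ι) : CompleteSpace (W.space i).toSubmodule :=
  (W.space i).isClosed.completeSpace_coe

/-- The Hilbert space `(∑ ⊕ Wᵢ)_{ℓ²}`. -/
abbrev HilbertSum (W : WeightedSubspaces ι 𝕜 H) : Type _ :=
  lp (fun i => (W.space i).toSubmodule) 2

/-- The operator `f ↦ (wᵢ π_{Wᵢ} f)ᵢ`. -/
def analysis (W : WeightedSubspaces ι 𝕜 H) (hW : W.IsBessel) : H →L[𝕜] W.HilbertSum :=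
  toHilbertSum (fun i => (W.weight i : 𝕜) • (W.space i).toSubmodule.orthogonalProjectionOnto) (by
    simpa [norm_smul, mul_pow, sq_abs] using! hW)

theorem analysis_apply (W : WeightedSubspaces ι 𝕜 H) (hW : W.IsBessel) (f : H) (i : ι) :
    ((W.analysis hW f i : (W.space i).toSubmodule) : H) =
      (W.weight i : 𝕜) • (W.space i).toSubmodule.starProjection f := rfl

theorem hasSum_adjoint_analysis (W : WeightedSubspaces ι 𝕜 H) (hW : W.IsBessel)
    (f : W.HilbertSum) :
    HasSum (fun i => (W.weight i : 𝕜) • (f i : H))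
      (ContinuousLinearMap.adjoint (W.analysis hW) f) := by
  classical
  have h := (lp.hasSum_single (p := 2) (by simp) f).mapL
    (ContinuousLinearMap.adjoint (W.analysis hW))
  convert h using 2 with i
  refine ext_inner_right 𝕜 fun x => ?_
  rw [ContinuousLinearMap.adjoint_inner_left, lp.inner_single_left, Submodule.coe_inner,
    analysis_apply, inner_smul_left, inner_smul_right, RCLike.conj_ofReal,
    Submodule.starProjection_apply, ← Submodule.coe_inner,
    Submodule.inner_orthogonalProjectionOnto_eq_of_mem_left]

/-- The synthesis operator `T_W (fᵢ)ᵢ = ∑ wᵢ fᵢ`. -/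
def synthesis (W : WeightedSubspaces ι 𝕜 H) (hW : W.IsBessel) : W.HilbertSum →L[𝕜] H :=
  (ContinuousLinearMap.adjoint (W.analysis hW)).copy
    (fun f => ∑' i, (W.weight i : 𝕜) • (f i : H))
    (funext fun f => (W.hasSum_adjoint_analysis hW f).tsum_eq)

theorem synthesis_eq (W : WeightedSubspaces ι 𝕜 H) (hW : W.IsBessel) :
    W.synthesis hW = ContinuousLinearMap.adjoint (W.analysis hW) :=
  ContinuousLinearMap.copy_eq _ _ _

/-- The adjoint of the synthesis operator is the analysis operator `f ↦ (wᵢ π_{Wᵢ} f)ᵢ`. -/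
theorem adjoint_synthesis (W : WeightedSubspaces ι 𝕜 H) (hW : W.IsBessel) :
    ContinuousLinearMap.adjoint (W.synthesis hW) = W.analysis hW := by
  rw [synthesis_eq, ContinuousLinearMap.adjoint_adjoint]

/-- The fusion frame operator `S_W = T_W T_W*`. -/
def frameOperator (W : WeightedSubspaces ι 𝕜 H) (hW : W.IsBessel) : H →L[𝕜] H :=
  W.synthesis hW ∘L ContinuousLinearMap.adjoint (W.synthesis hW)

theorem frameOperator_eq (W : WeightedSubspaces ι 𝕜 H) (hW : W.IsBessel) :
    W.frameOperator hW = ContinuousLinearMap.adjoint (W.analysis hW) ∘L W.analysis hW := by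
  rw [frameOperator, adjoint_synthesis, synthesis_eq]

theorem isSelfAdjoint_frameOperator (W : WeightedSubspaces ι 𝕜 H) (hW : W.IsBessel) :
    IsSelfAdjoint (W.frameOperator hW) := by
  rw [ContinuousLinearMap.isSelfAdjoint_iff', frameOperator, ContinuousLinearMap.adjoint_comp,
    ContinuousLinearMap.adjoint_adjoint]

theorem re_inner_frameOperator (W : WeightedSubspaces ι 𝕜 H) (hW : W.IsBessel) (f : H) :
    RCLike.re ⟪W.frameOperator hW f, f⟫_𝕜 =
      ∑' i, W.weight i ^ 2 * ‖(W.space i).toSubmodule.starProjection f‖ ^ 2 := by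
  rw [frameOperator_eq, ContinuousLinearMap.comp_apply, ContinuousLinearMap.adjoint_inner_left,
    inner_self_eq_norm_sq]
  have h := lp.norm_rpow_eq_tsum (p := 2) (by simp) (W.analysis hW f)
  have h2 : ((2 : ℝ≥0∞).toReal) = 2 := by simp
  simp only [h2, Real.rpow_two] at h
  rw [h]
  congr! 2 with i
  change ‖((W.analysis hW f i : (W.space i).toSubmodule) : H)‖ ^ 2 = _
  rw [analysis_apply, norm_smul, mul_pow, RCLike.norm_ofReal, sq_abs]

/-- The fusion frame operator of a fusion frame is invertible. -/
theorem IsFusionFrame.isUnit_frameOperator {W : WeightedSubspaces ι 𝕜 H}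
    (hW : W.IsFusionFrame) : IsUnit (W.frameOperator hW.isBessel) := by
  obtain ⟨A, B, hA, -, h⟩ := id hW
  refine ContinuousLinearMap.isUnit_of_forall_le_norm_inner_map _ (c := ⟨A, hA.le⟩) hA fun f => ?_
  have h1 := (h f).2.1
  rw [← W.re_inner_frameOperator hW.isBessel] at h1
  rw [mul_comm]
  exact h1.trans (RCLike.re_le_norm _)

/-- The fusion frame operator of a fusion frame has a positive square root. -/
theorem IsFusionFrame.exists_posSqrt {W : WeightedSubspaces ι 𝕜 H} (hW : W.IsFusionFrame) :
    ∃ R : H →L[𝕜] H, R.IsPositive ∧ R ∘L R = W.frameOperator hW.isBessel := by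
  obtain ⟨A, B, hA, -, h⟩ := id hW
  refine FusionFrames.exists_posSqrt (W.isSelfAdjoint_frameOperator hW.isBessel) hA fun f => ?_
  rw [W.re_inner_frameOperator hW.isBessel]
  exact (h f).2.1

end WeightedSubspaces

open WeightedSubspaces

variable {W V : WeightedSubspaces ι 𝕜 H}

/-- `M^{(W,V)} = T_W* ⊗ T_V*`, that is `M^{(W,V)}(O) = T_W* O T_V`, on bounded operators. -/
def matrixRep (hW : W.IsBessel) (hV : V.IsBessel) :
    (H →L[𝕜] H) →ₗ[𝕜] (V.HilbertSum →L[𝕜] W.HilbertSum) :=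
  tensor (ContinuousLinearMap.adjoint (W.synthesis hW))
    (ContinuousLinearMap.adjoint (V.synthesis hV))

/-- `M^{(W,V)}(O)` is the block matrix with the entries `wᵢ vⱼ π_{Wᵢ} O π_{Vⱼ}`. -/
theorem hasSum_matrixRep (hW : W.IsBessel) (hV : V.IsBessel) (O : H →L[𝕜] H)
    (f : V.HilbertSum) (i : ι) :
    HasSum (fun j => ((W.weight i * V.weight j : ℝ) : 𝕜) •
        (W.space i).toSubmodule.starProjection (O (f j : H)))
      ((matrixRep hW hV O f i : (W.space i).toSubmodule) : H) := by
  have h := ((V.hasSum_adjoint_analysis hV f).mapL O).mapL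
    ((W.weight i : 𝕜) • (W.space i).toSubmodule.starProjection)
  convert h using 1
  · ext j
    simp [smul_smul, mul_comm]
  · rw [← synthesis_eq]
    simp only [matrixRep, tensor, LinearMap.coe_mk, AddHom.coe_mk,
      ContinuousLinearMap.adjoint_adjoint, ContinuousLinearMap.comp_apply, adjoint_synthesis W,
      analysis_apply]
    rfl

/-- `O^{(W,V)} = T_W ⊗ T_V`, that is `O^{(W,V)}(M) = T_W M T_V*`, on bounded operators. -/
def operatorRep (hW : W.IsBessel) (hV : V.IsBessel) :
    (V.HilbertSum →L[𝕜] W.HilbertSum) →ₗ[𝕜] (H →L[𝕜] H) :=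
  tensor (W.synthesis hW) (V.synthesis hV)

/-- `M_⊗^{(W,V)} = M^{(W,V)} ∘ (S_W^{-1/2} ⊗ S_V^{-1/2})`. -/
def matrixRepTensor (hW : W.IsFusionFrame) (hV : V.IsFusionFrame) :
    (H →L[𝕜] H) →ₗ[𝕜] (V.HilbertSum →L[𝕜] W.HilbertSum) :=
  matrixRep hW.isBessel hV.isBessel ∘ₗ
    tensor (invSqrt (W.frameOperator hW.isBessel)) (invSqrt (V.frameOperator hV.isBessel))

/-- `O_⊗^{(W,V)} = (S_W^{-1/2} ⊗ S_V^{-1/2}) ∘ O^{(W,V)}`. -/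
def operatorRepTensor (hW : W.IsFusionFrame) (hV : V.IsFusionFrame) :
    (V.HilbertSum →L[𝕜] W.HilbertSum) →ₗ[𝕜] (H →L[𝕜] H) :=
  tensor (invSqrt (W.frameOperator hW.isBessel)) (invSqrt (V.frameOperator hV.isBessel)) ∘ₗ
    operatorRep hW.isBessel hV.isBessel

/-- The restriction of `M^{(W,V)}` to the Hilbert–Schmidt operators. -/
def matrixRepHS (hW : W.IsBessel) (hV : V.IsBessel) :
    S2 𝕜 H H →L[𝕜] S2 𝕜 V.HilbertSum W.HilbertSum :=
  tensorHS (ContinuousLinearMap.adjoint (W.synthesis hW))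
    (ContinuousLinearMap.adjoint (V.synthesis hV))

/-- The restriction of `O^{(W,V)}` to the Hilbert–Schmidt operators. -/
def operatorRepHS (hW : W.IsBessel) (hV : V.IsBessel) :
    S2 𝕜 V.HilbertSum W.HilbertSum →L[𝕜] S2 𝕜 H H :=
  tensorHS (W.synthesis hW) (V.synthesis hV)

/-- The restriction of `M_⊗^{(W,V)}` to the Hilbert–Schmidt operators. -/
def matrixRepTensorHS (hW : W.IsFusionFrame) (hV : V.IsFusionFrame) :
    S2 𝕜 H H →L[𝕜] S2 𝕜 V.HilbertSum W.HilbertSum :=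
  matrixRepHS hW.isBessel hV.isBessel ∘L
    tensorHS (invSqrt (W.frameOperator hW.isBessel)) (invSqrt (V.frameOperator hV.isBessel))

/-- The restriction of `O_⊗^{(W,V)}` to the Hilbert–Schmidt operators. -/
def operatorRepTensorHS (hW : W.IsFusionFrame) (hV : V.IsFusionFrame) :
    S2 𝕜 V.HilbertSum W.HilbertSum →L[𝕜] S2 𝕜 H H :=
  tensorHS (invSqrt (W.frameOperator hW.isBessel)) (invSqrt (V.frameOperator hV.isBessel)) ∘L
    operatorRepHS hW.isBessel hV.isBessel

theorem toCLM_matrixRepHS (hW : W.IsBessel) (hV : V.IsBessel) (O : S2 𝕜 H H) :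
    S2.toCLM 𝕜 _ _ (matrixRepHS hW hV O) = matrixRep hW hV (S2.toCLM 𝕜 _ _ O) := rfl

theorem toCLM_operatorRepHS (hW : W.IsBessel) (hV : V.IsBessel)
    (M : S2 𝕜 V.HilbertSum W.HilbertSum) :
    S2.toCLM 𝕜 _ _ (operatorRepHS hW hV M) = operatorRep hW hV (S2.toCLM 𝕜 _ _ M) := rfl

theorem toCLM_matrixRepTensorHS (hW : W.IsFusionFrame) (hV : V.IsFusionFrame) (O : S2 𝕜 H H) :
    S2.toCLM 𝕜 _ _ (matrixRepTensorHS hW hV O) =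
      matrixRepTensor hW hV (S2.toCLM 𝕜 _ _ O) := rfl

theorem toCLM_operatorRepTensorHS (hW : W.IsFusionFrame) (hV : V.IsFusionFrame)
    (M : S2 𝕜 V.HilbertSum W.HilbertSum) :
    S2.toCLM 𝕜 _ _ (operatorRepTensorHS hW hV M) =
      operatorRepTensor hW hV (S2.toCLM 𝕜 _ _ M) := rfl

end Fusion

end FusionFrames
end

noncomputable section

namespace FusionFrames

open scoped ENNReal InnerProductSpace

section HilbertSchmidt

variable {𝕜 : Type*} [RCLike 𝕜]
variable {E : Type*} [NormedAddCommGroup E] [InnerProductSpace 𝕜 E] [CompleteSpace E]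
variable {F : Type*} [NormedAddCommGroup F] [InnerProductSpace 𝕜 F] [CompleteSpace F]
variable {G : Type*} [NormedAddCommGroup G] [InnerProductSpace 𝕜 G] [CompleteSpace G]
variable {K : Type*} [NormedAddCommGroup K] [InnerProductSpace 𝕜 K] [CompleteSpace K]

/-! Write `U` for the map `O ↦ T_W* O T_V` on the Hilbert–Schmidt class. Everything rests on two
rules of calculation there: `(S ⊗ T)(S' ⊗ T') = SS' ⊗ TT'` (`tensorHS_comp`) and `(S ⊗ T)* = S* ⊗
T*` (`adjoint_tensorHS`). They give `U* = T_W ⊗ T_V`, which is `operatorRepHS`, and `U* U = S_W ⊗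
S_V`. The frame operators are invertible, so `R = S_W⁻¹ ⊗ S_V⁻¹` inverts `U* U`, and `R U*` is a
bounded left inverse of `U`. A bounded left inverse forces closed range, and a left inverse of the
shape `R U*` with `R` injective is the pseudo-inverse (`isPseudoInverse_of_leftInverse`).

For the second claim, compose `U` with `S_W^{-1/2} ⊗ S_V^{-1/2}`. Since `S^{-1/2}` is self-adjoint
and `S^{-1/2} S S^{-1/2} = 1`, the new map is an isometry. The same criterion applies with `R = 1`,
so the pseudo-inverse is the adjoint.

The delicate rule is the one for adjoints. With the inner product `trace (A* B)`, the left factor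
`S` moves across at once, but the right factor `T` would need cyclicity of the trace. Instead, the
isometry `A ↦ A*` turns the right factor into a left one. It is conjugate-linear and therefore
preserves only real parts of inner products, which still determine an adjoint. -/

/-- To identify an adjoint it suffices to compare real parts of inner products. -/
theorem eq_adjoint_of_re_inner_eq {A : E →L[𝕜] F} {B : F →L[𝕜] E}
    (h : ∀ x y, RCLike.re ⟪A x, y⟫_𝕜 = RCLike.re ⟪x, B y⟫_𝕜) :
    A = ContinuousLinearMap.adjoint B := by
  rw [ContinuousLinearMap.eq_adjoint_iff]
  intro x y
  set z := ⟪A x, y⟫_𝕜 - ⟪x, B y⟫_𝕜 with hz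
  -- Scaling `x` by the discrepancy `z` itself turns the real part of the difference into `‖z‖²`.
  have h1 := h (z • x) y
  rw [map_smul, inner_smul_left, inner_smul_left, ← sub_eq_zero, ← map_sub, ← mul_sub, ← hz,
    RCLike.conj_mul, ← RCLike.ofReal_pow, RCLike.ofReal_re] at h1
  exact sub_eq_zero.mp (norm_eq_zero.mp (pow_eq_zero_iff two_ne_zero |>.mp h1))

/-! ### Taking adjoints in the Hilbert–Schmidt class -/

theorem IsHilbertSchmidt.adjoint {T : E →L[𝕜] F} (hT : IsHilbertSchmidt T) :
    IsHilbertSchmidt (ContinuousLinearMap.adjoint T) := by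
  rw [IsHilbertSchmidt, summable_iff_tsum_ne_top (fun i => by positivity)] at hT ⊢
  rwa [← tsum_adjoint (onb 𝕜 E)]

namespace S2

/-- The adjoint of a Hilbert–Schmidt operator, as a Hilbert–Schmidt operator. -/
def adj (T : S2 𝕜 E F) : S2 𝕜 F E :=
  mk (ContinuousLinearMap.adjoint (toCLM 𝕜 E F T)) T.isHilbertSchmidt.adjoint

@[simp] theorem toCLM_adj (T : S2 𝕜 E F) :
    toCLM 𝕜 F E T.adj = ContinuousLinearMap.adjoint (toCLM 𝕜 E F T) := rfl

/-- `adj` is conjugate-linear; additivity is all that polarization needs below. -/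
theorem adj_add (S T : S2 𝕜 E F) : (S + T).adj = S.adj + T.adj :=
  toCLM_injective (by simp)

/-- Both squared norms sum `‖⟨f_j, T e_i⟩‖²` over all pairs of basis vectors, only in a different
order; this is `tsum_adjoint`. -/
theorem norm_adj (T : S2 𝕜 E F) : ‖T.adj‖ = ‖T‖ := by
  refine (pow_left_inj₀ (norm_nonneg _) (norm_nonneg _) two_ne_zero).mp ?_
  rw [← ENNReal.ofReal_eq_ofReal_iff (by positivity) (by positivity),
    ofReal_norm_sq (onb 𝕜 E) T, ofReal_norm_sq (onb 𝕜 F) T.adj, tsum_adjoint (onb 𝕜 E) (onb 𝕜 F)]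
  rfl

/-- Polarization: the real part of the inner product is determined by the norms of `S`, `T` and `S +
T`, which `adj` preserves. -/
theorem re_inner_adj (S T : S2 𝕜 E F) :
    RCLike.re ⟪S.adj, T.adj⟫_𝕜 = RCLike.re ⟪S, T⟫_𝕜 := by
  have h1 := norm_add_sq (𝕜 := 𝕜) S T
  have h2 := norm_add_sq (𝕜 := 𝕜) S.adj T.adj
  rw [← adj_add, norm_adj, norm_adj, norm_adj] at h2
  linarith

end S2

/-! ### Composition and adjoints of `S ⊗ T` -/

theorem tensor_tensor {E' F' : Type*} [NormedAddCommGroup E'] [InnerProductSpace 𝕜 E']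
    [CompleteSpace E'] [NormedAddCommGroup F'] [InnerProductSpace 𝕜 F'] [CompleteSpace F']
    (S : F →L[𝕜] K) (T : E →L[𝕜] G) (S' : F' →L[𝕜] F) (T' : E' →L[𝕜] E) (O : E' →L[𝕜] F') :
    tensor S T (tensor S' T' O) = tensor (S ∘L S') (T ∘L T') O := by
  simp [tensor, ContinuousLinearMap.adjoint_comp, ContinuousLinearMap.comp_assoc]

theorem tensorHS_comp {E' F' : Type*} [NormedAddCommGroup E'] [InnerProductSpace 𝕜 E']
    [CompleteSpace E'] [NormedAddCommGroup F'] [InnerProductSpace 𝕜 F'] [CompleteSpace F']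
    (S : F →L[𝕜] K) (T : E →L[𝕜] G) (S' : F' →L[𝕜] F) (T' : E' →L[𝕜] E) :
    tensorHS S T ∘L tensorHS S' T' = tensorHS (S ∘L S') (T ∘L T') := by
  ext O
  exact S2.toCLM_injective (tensor_tensor S T S' T' _)

theorem tensorHS_id :
    tensorHS (.id 𝕜 F) (.id 𝕜 E) = ContinuousLinearMap.id 𝕜 (S2 𝕜 E F) := by
  ext O
  refine S2.toCLM_injective ?_
  rw [toCLM_tensorHS]
  ext x
  simp [tensor, ContinuousLinearMap.adjoint_id]

/-- Both traces are of the same operator `O* S* P`, so no property of the trace is used. -/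
theorem inner_tensorHS_id (S : F →L[𝕜] K) (O : S2 𝕜 E F) (P : S2 𝕜 E K) :
    ⟪tensorHS S (.id 𝕜 E) O, P⟫_𝕜 =
      ⟪O, tensorHS (ContinuousLinearMap.adjoint S) (.id 𝕜 E) P⟫_𝕜 := by
  rw [S2.inner_def, S2.inner_def]
  congr 1
  simp [tensor, ContinuousLinearMap.adjoint_id, ContinuousLinearMap.adjoint_comp,
    ContinuousLinearMap.comp_assoc]

/-- Since `(S O T*)* = T O* S*`, the two factors trade places. This carries statements about the
left factor over to the right one. -/
theorem adj_tensorHS (S : F →L[𝕜] K) (T : E →L[𝕜] G) (O : S2 𝕜 E F) :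
    (tensorHS S T O).adj = tensorHS T S O.adj :=
  S2.toCLM_injective (by
    simp [tensor, ContinuousLinearMap.adjoint_comp, ContinuousLinearMap.comp_assoc])

/-- `(S ⊗ T)* = S* ⊗ T*` on the Hilbert–Schmidt class. -/
theorem adjoint_tensorHS (S : F →L[𝕜] K) (T : E →L[𝕜] G) :
    ContinuousLinearMap.adjoint (tensorHS S T) =
      tensorHS (ContinuousLinearMap.adjoint S) (ContinuousLinearMap.adjoint T) := by
  -- Splitting off one factor at a time lets `S` and `T` be moved across the inner product
  -- separately.
  have h1 : tensorHS S T = tensorHS S (.id 𝕜 G) ∘L tensorHS (.id 𝕜 F) T := by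
    rw [tensorHS_comp]; rfl
  have h2 : tensorHS (ContinuousLinearMap.adjoint S) (ContinuousLinearMap.adjoint T) =
      tensorHS (.id 𝕜 F) (ContinuousLinearMap.adjoint T) ∘L
        tensorHS (ContinuousLinearMap.adjoint S) (.id 𝕜 G) := by
    rw [tensorHS_comp]; rfl
  refine (eq_adjoint_of_re_inner_eq fun P O => ?_).symm
  -- `S` crosses directly by `inner_tensorHS_id`. For `T`, both arguments are replaced by their
  -- adjoints, where `T` acts on the left; it crosses there, and the adjoints are then undone.
  rw [inner_re_symm, inner_re_symm P, h1, h2, ContinuousLinearMap.comp_apply,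
    ContinuousLinearMap.comp_apply, inner_tensorHS_id, ← S2.re_inner_adj, adj_tensorHS,
    ← ContinuousLinearMap.adjoint_adjoint T, ← inner_tensorHS_id,
    ContinuousLinearMap.adjoint_adjoint, ← adj_tensorHS, S2.re_inner_adj]

/-! ### Closed range and pseudo-inverse from a left inverse -/

theorem isClosed_range_of_leftInverse {U : E →L[𝕜] F} {P : F →L[𝕜] E}
    (h : P ∘L U = .id 𝕜 E) : IsClosed (U.range : Set F) := by
  rw [LinearMap.coe_range]
  -- The range is the set where the continuous maps `U P` and the identity agree.
  exact Function.LeftInverse.isClosed_range (f := P) (g := U)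
    (fun x => DFunLike.congr_fun h x) P.continuous U.continuous

/-- A left inverse of `U` of the form `R U*` with `R` injective is the pseudo-inverse of `U`. -/
theorem isPseudoInverse_of_leftInverse {U : E →L[𝕜] F} {R : E →L[𝕜] E}
    (hR : Function.Injective R) (h : (R ∘L ContinuousLinearMap.adjoint U) ∘L U = .id 𝕜 E) :
    IsPseudoInverse U (R ∘L ContinuousLinearMap.adjoint U) := by
  have h' : ∀ x, R (ContinuousLinearMap.adjoint U (U x)) = x := DFunLike.congr_fun h
  refine ⟨?_, ?_, ?_⟩
  · have h1 : (R ∘L ContinuousLinearMap.adjoint U).range = ⊤ :=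
      LinearMap.range_eq_top.mpr fun x => ⟨U x, h' x⟩
    -- `R U* U = 1` makes `R` surjective; being injective as well, it is bijective with inverse `U*
    -- U`, so `U*` is onto.
    have h2 : (ContinuousLinearMap.adjoint U).range = ⊤ :=
      LinearMap.range_eq_top.mpr fun x => ⟨U (R x), hR (h' (R x))⟩
    rw [h1, h2]
  · ext y
    exact map_eq_zero_iff R hR
  · rw [h, ContinuousLinearMap.comp_id]

/-! ### Inverses and inverse square roots -/

theorem isInvertible_of_isUnit {T : E →L[𝕜] E} (hT : IsUnit T) : T.IsInvertible := by
  obtain ⟨u, rfl⟩ := hT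
  exact ⟨ContinuousLinearEquiv.unitsEquiv 𝕜 E u, rfl⟩

/-- An operator whose square is a unit is itself a unit. This matters because `inverse` takes the
value `0` at a non-invertible operator, so `invSqrt` is meaningful only once this is known. -/
theorem isInvertible_posSqrt {T : E →L[𝕜] E} (hT : IsUnit T)
    (h : ∃ R : E →L[𝕜] E, R.IsPositive ∧ R ∘L R = T) : (posSqrt T).IsInvertible := by
  refine isInvertible_of_isUnit ((isUnit_pow_iff two_ne_zero).mp ?_)
  rw [sq]
  change IsUnit (posSqrt T ∘L posSqrt T)
  rwa [(posSqrt_spec h).2]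

theorem adjoint_invSqrt {T : E →L[𝕜] E} (hT : IsUnit T)
    (h : ∃ R : E →L[𝕜] E, R.IsPositive ∧ R ∘L R = T) :
    ContinuousLinearMap.adjoint (invSqrt T) = invSqrt T := by
  have hi := isInvertible_posSqrt hT h
  have hs := (posSqrt_spec h).1.isSelfAdjoint
  symm
  rw [ContinuousLinearMap.eq_adjoint_iff]
  intro x y
  -- With `R = posSqrt T`, writing `y = R R⁻¹ y` and `x = R R⁻¹ x` reduces the symmetry of `R⁻¹` to
  -- that of `R`, tested on `R⁻¹ x` and `R⁻¹ y`.
  conv_lhs => rw [← hi.self_apply_inverse y]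
  conv_rhs => rw [← hi.self_apply_inverse x]
  exact (hs.isSymmetric _ _).symm

theorem invSqrt_comp_comp_invSqrt {T : E →L[𝕜] E} (hT : IsUnit T)
    (h : ∃ R : E →L[𝕜] E, R.IsPositive ∧ R ∘L R = T) :
    invSqrt T ∘L T ∘L invSqrt T = .id 𝕜 E := by
  have hi := isInvertible_posSqrt hT h
  ext x
  have e : T (invSqrt T x) = posSqrt T (posSqrt T (invSqrt T x)) :=
    (DFunLike.congr_fun (posSqrt_spec h).2 _).symm
  rw [ContinuousLinearMap.comp_apply, ContinuousLinearMap.comp_apply, e, invSqrt,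
    hi.self_apply_inverse, hi.inverse_apply_self, ContinuousLinearMap.id_apply]

end HilbertSchmidt

/-! ### The representations attached to two fusion frames -/

section Fusion

open WeightedSubspaces

variable {ι : Type*} {𝕜 : Type*} [RCLike 𝕜]
variable {H : Type*} [NormedAddCommGroup H] [InnerProductSpace 𝕜 H] [CompleteSpace H]
variable {W V : WeightedSubspaces ι 𝕜 H}

theorem adjoint_matrixRepHS (hW : W.IsBessel) (hV : V.IsBessel) :
    ContinuousLinearMap.adjoint (matrixRepHS hW hV) = operatorRepHS hW hV := by
  simp [matrixRepHS, operatorRepHS, adjoint_tensorHS]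

/-- The factors multiply to `T_W T_W*` and `T_V T_V*`, which are the frame operators by definition.
-/
theorem operatorRepHS_comp_matrixRepHS (hW : W.IsBessel) (hV : V.IsBessel) :
    operatorRepHS hW hV ∘L matrixRepHS hW hV =
      tensorHS (W.frameOperator hW) (V.frameOperator hV) :=
  tensorHS_comp _ _ _ _

theorem adjoint_matrixRepTensorHS (hW : W.IsFusionFrame) (hV : V.IsFusionFrame) :
    ContinuousLinearMap.adjoint (matrixRepTensorHS hW hV) = operatorRepTensorHS hW hV := by
  rw [matrixRepTensorHS, ContinuousLinearMap.adjoint_comp, adjoint_matrixRepHS, adjoint_tensorHS,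
    adjoint_invSqrt hW.isUnit_frameOperator hW.exists_posSqrt,
    adjoint_invSqrt hV.isUnit_frameOperator hV.exists_posSqrt, operatorRepTensorHS]

theorem inverse_tensorHS_comp_operatorRepHS_comp_matrixRepHS (hW : W.IsFusionFrame)
    (hV : V.IsFusionFrame) :
    (tensorHS (W.frameOperator hW.isBessel).inverse (V.frameOperator hV.isBessel).inverse ∘L
      operatorRepHS hW.isBessel hV.isBessel) ∘L matrixRepHS hW.isBessel hV.isBessel =
      .id 𝕜 (S2 𝕜 H H) := by
  rw [ContinuousLinearMap.comp_assoc, operatorRepHS_comp_matrixRepHS, tensorHS_comp,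
    (isInvertible_of_isUnit hW.isUnit_frameOperator).inverse_comp_self,
    (isInvertible_of_isUnit hV.isUnit_frameOperator).inverse_comp_self, tensorHS_id]

/-- In each factor the product collapses to `S^{-1/2} S S^{-1/2} = 1`. Together with
`adjoint_matrixRepTensorHS` this says that `matrixRepTensorHS` is an isometry. -/
theorem operatorRepTensorHS_comp_matrixRepTensorHS (hW : W.IsFusionFrame)
    (hV : V.IsFusionFrame) :
    operatorRepTensorHS hW hV ∘L matrixRepTensorHS hW hV = .id 𝕜 (S2 𝕜 H H) := by
  rw [operatorRepTensorHS, matrixRepTensorHS, ContinuousLinearMap.comp_assoc,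
    ← ContinuousLinearMap.comp_assoc (operatorRepHS _ _), operatorRepHS_comp_matrixRepHS,
    tensorHS_comp, tensorHS_comp,
    invSqrt_comp_comp_invSqrt hW.isUnit_frameOperator hW.exists_posSqrt,
    invSqrt_comp_comp_invSqrt hV.isUnit_frameOperator hV.exists_posSqrt, tensorHS_id]

/-- Supplies the injectivity of `R` in `isPseudoInverse_of_leftInverse`; `S_W ⊗ S_V` undoes `R`. -/
theorem injective_tensorHS_inverse (hW : W.IsFusionFrame) (hV : V.IsFusionFrame) :
    Function.Injective
      (tensorHS (W.frameOperator hW.isBessel).inverse (V.frameOperator hV.isBessel).inverse) := by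
  have h : tensorHS (W.frameOperator hW.isBessel) (V.frameOperator hV.isBessel) ∘L
      tensorHS (W.frameOperator hW.isBessel).inverse (V.frameOperator hV.isBessel).inverse =
      .id 𝕜 (S2 𝕜 H H) := by
    rw [tensorHS_comp, (isInvertible_of_isUnit hW.isUnit_frameOperator).self_comp_inverse,
      (isInvertible_of_isUnit hV.isUnit_frameOperator).self_comp_inverse, tensorHS_id]
  exact Function.LeftInverse.injective
    (g := tensorHS (W.frameOperator hW.isBessel) (V.frameOperator hV.isBessel))
    fun x => DFunLike.congr_fun h x

end Fusion

end FusionFrames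

end


open FusionFrames in
theorem mainTheorem4 {ι 𝕜 H : Type*} [RCLike 𝕜] [NormedAddCommGroup H] [InnerProductSpace 𝕜 H]
    [CompleteSpace H] (W V : WeightedSubspaces ι 𝕜 H)
    (hW : W.IsFusionFrame) (hV : V.IsFusionFrame) :
    (IsClosed ((matrixRepHS hW.isBessel hV.isBessel).range :
        Set (S2 𝕜 V.HilbertSum W.HilbertSum)) ∧
      IsPseudoInverse (matrixRepHS hW.isBessel hV.isBessel)
        (tensorHS (W.frameOperator hW.isBessel).inverse (V.frameOperator hV.isBessel).inverse ∘L
          operatorRepHS hW.isBessel hV.isBessel)) ∧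
    (IsClosed ((matrixRepTensorHS hW hV).range : Set (S2 𝕜 V.HilbertSum W.HilbertSum)) ∧
      IsPseudoInverse (matrixRepTensorHS hW hV) (operatorRepTensorHS hW hV)) := by
  have h1 := inverse_tensorHS_comp_operatorRepHS_comp_matrixRepHS hW hV
  have h2 := operatorRepTensorHS_comp_matrixRepTensorHS hW hV
  refine ⟨⟨isClosed_range_of_leftInverse h1, ?_⟩, isClosed_range_of_leftInverse h2, ?_⟩
  · rw [← adjoint_matrixRepHS] at h1 ⊢
    exact isPseudoInverse_of_leftInverse (injective_tensorHS_inverse hW hV) h1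
  -- The adjoint alone is the left inverse here; the identity is inserted in front of it to serve as
  -- `R`.
  · rw [← adjoint_matrixRepTensorHS, ← ContinuousLinearMap.id_comp (ContinuousLinearMap.adjoint _)]
      at h2 ⊢
    exact isPseudoInverse_of_leftInverse Function.injective_id h2
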